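/- For a positive integer $n$, let $N(0,I_n)$ be the standard Gaussian distribution on $\mathbb{R}^n$, let $\mathrm{Vol}(K)=\Pr_{x\sim N(0,I_n)}[x\in K]$, and let $\mathrm{dist}_{\mathrm G}(K,L)=\mathrm{Vol}(K\,\triangle\,L)$. For a convex set $K\subseteq\mathbb{R}^n$ containing the origin, let $$\mathbf{Inf}_v[K]=\mathbb{E}_{x\sim N(0,I_n)}\bigl[\mathbf 1_K(x)\,(1-\langle x,v\rangle^2)\bigr]\quad(\|v\|=1),\qquad \mathbf{TInf}[K]=\sum_{i=1}^n\mathbf{Inf}_{e_i}[K]$$ be the convex influence of the direction $v$ on $K$ and the total convex influence of $K$, where $e_1,\dots,e_n$ is the standard basis. **Theorem.** There is an absolute constant $c>0$ such that the following holds for every $n$. Let $K\subseteq\mathbb{R}^n$ be a convex set that is symmetric ($x\in K$ implies $-x\in K$), with $|\mathrm{Vol}(K)-\tfrac12|\le c$ and $\mathbf{TInf}[K]\ge 0.1\sqrt n$. If $L\subseteq\mathbb{R}^n$ is an intersection of $M$ (closed) halfspaces, where $M$ is finite, and $\mathrm{dist}_{\mathrm G}(K,L)\le 6.25\times10^{-7}$,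 then $$M\ \ge\ 2^{5.1\times10^{-6}\sqrt n}.$$ In particular, this applies, for all sufficiently large $n$, to symmetric convex sets $K=K_n\subseteq\mathbb{R}^n$ with $\mathrm{Vol}(K_n)=\tfrac12\pm o_n(1)$ and $\mathbf{TInf}[K_n]\ge0.1\sqrt n$. -/

import Mathlib

open MeasureTheory ProbabilityTheory

/-- Gaussian volume of `K ⊆ ℝⁿ`: the mass of `K` under the standard Gaussian `N(0, Iₙ)`. -/
noncomputable def gaussianVol {n : ℕ} (K : Set (EuclideanSpace ℝ (Fin n))) : ℝ :=
  (stdGaussian (EuclideanSpace ℝ (Fin n))).real K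

/-- Gaussian distance: the Gaussian volume of the symmetric difference. -/
noncomputable def gaussianDist {n : ℕ} (K L : Set (EuclideanSpace ℝ (Fin n))) : ℝ :=
  gaussianVol (symmDiff K L)

/-- Convex influence of the direction `v` on `K`: the expectation of `K(x) (1 - ⟨x, v⟩²)` for
`x ∼ N(0, Iₙ)`, where `K(·)` is the 0/1-valued indicator function of `K`. -/
noncomputable def convexInfluence {n : ℕ} (v : EuclideanSpace ℝ (Fin n))
    (K : Set (EuclideanSpace ℝ (Fin n))) : ℝ :=
  ∫ x, K.indicator (fun _ => (1 : ℝ)) x * (1 - (inner ℝ x v) ^ 2)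
    ∂(stdGaussian (EuclideanSpace ℝ (Fin n)))

/-- Total convex influence: the sum of the convex influences of the standard basis vectors. -/
noncomputable def totalConvexInfluence {n : ℕ} (K : Set (EuclideanSpace ℝ (Fin n))) : ℝ :=
  ∑ i : Fin n, convexInfluence (EuclideanSpace.single i (1 : ℝ)) K

/-- `L` is an intersection of `M` halfspaces `{x | ⟨x, v⟩ ≤ θ}` with unit normal vectors `v`. -/
def IsHalfspaceInter {n : ℕ} (M : ℕ) (L : Set (EuclideanSpace ℝ (Fin n))) : Prop :=
  ∃ (v : Fin M → EuclideanSpace ℝ (Fin n)) (θ : Fin M → ℝ),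
    (∀ i, ‖v i‖ = 1) ∧ L = ⋂ i, {x | inner ℝ x (v i) ≤ θ i}

/-!
The total convex influence of `K` is `TInf[K] = 𝔼[1_K(x) (n - ‖x‖²)]`, which is also the derivative
at `t = 1` of the Gaussian volume of `t K`. The theorem follows from two facts about it.

* It is stable: `TInf[K] - TInf[L]` is the integral of `n - ‖x‖²` against a function supported on
  `K ∆ L`, and `n - ‖x‖²` has standard deviation `O(√n)`, so the difference is at most a small
  multiple of `√n` when `dist(K, L)` is a small constant (`totalConvexInfluence_sub_le`).
* It is small for polytopes: an intersection `L` of `M ≥ 2` halfspaces has `TInf[L] = O(log M)`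
  (`totalConvexInfluence_le_log`).

Hence `TInf[K] ≥ 0.1 √n` forces `log M` to be at least a constant multiple of `√n`. The constant in
the statement is far from what the argument gives, so the numerical bounds below are generous. The
values `M = 0` and `M = 1` are excluded by symmetry: a halfspace and its reflection cover the space
or are disjoint, so a halfspace is not close to a symmetric set of volume near `1/2`
(`two_le_of_gaussianDist_lt`).

The bound for polytopes is obtained from finite dilations. By the explicit Gaussian density,
`Vol((1 + h) L) - Vol(L) ≥ h TInf[L] - h² n` (`mul_setIntegral_le_dilation_sub`). For an upper bound
on the left side, split `ℝⁿ` into the regions where a given constraint is the most violated one.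
Such a region is closed under translation by nonnegative multiples of the normal vector of its
constraint, so its part in the thin slab `θ i < ⟨x, v i⟩ ≤ (1 + h) θ i` is bounded by the
width `h θ i` times the one-dimensional hazard rate at `θ i`, which is `O(1 + θ i)`, times the
measure of the whole region
(`stdGaussian_slab_inter_mul_le`). The measures of the regions add up to at most `1`, and the slabs
with `θ i` above `2 √(log M)` contribute `O(h)` in total (`stdGaussian_dilation_sub_le`).
-/

/-! ### The Gaussian density and dilations -/

section Density

variable {E : Type*} [NormedAddCommGroup E] [InnerProductSpace ℝ E]

/-- The density `(2π)^(-d/2) exp (-‖x‖² / 2)` of the standard Gaussian on `E`, `d = dim E`. -/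
noncomputable def stdGaussianPDFReal (x : E) : ℝ :=
  ((2 * Real.pi) ^ (Module.finrank ℝ E / 2 : ℝ))⁻¹ * Real.exp (-(1 / 2) * ‖x‖ ^ 2)

lemma stdGaussianPDFReal_nonneg (x : E) : 0 ≤ stdGaussianPDFReal x := by
  unfold stdGaussianPDFReal; positivity

variable [MeasurableSpace E] [BorelSpace E]

lemma measurable_stdGaussianPDFReal : Measurable (stdGaussianPDFReal (E := E)) := by
  unfold stdGaussianPDFReal; fun_prop

variable [FiniteDimensional ℝ E]

lemma integrable_stdGaussianPDFReal : Integrable (stdGaussianPDFReal (E := E)) := by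
  refine Integrable.const_mul ?_ _
  have h := (GaussianFourier.integrable_cexp_neg_mul_sq_norm_add (V := E) (b := (1 / 2 : ℂ))
    (by norm_num) 0 0).re
  refine h.congr (ae_of_all _ fun x => ?_)
  have : (-(1 / 2 : ℂ) * (‖x‖ : ℂ) ^ 2 + 0 * ((inner ℝ (0 : E) x : ℝ) : ℂ))
      = ((-(1 / 2) * ‖x‖ ^ 2 : ℝ) : ℂ) := by push_cast; ring
  simp only [this]
  exact Complex.exp_ofReal_re _

theorem stdGaussian_eq_withDensity :
    stdGaussian E = volume.withDensity fun x => ENNReal.ofReal (stdGaussianPDFReal x) := by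
  have := isFiniteMeasure_withDensity_ofReal (integrable_stdGaussianPDFReal (E := E)).2
  refine Measure.ext_of_charFun ?_
  ext t
  rw [charFun_stdGaussian, charFun_apply, integral_withDensity_eq_integral_toReal_smul
    measurable_stdGaussianPDFReal.ennreal_ofReal (ae_of_all _ fun _ => ENNReal.ofReal_lt_top)]
  have h := GaussianFourier.integral_cexp_neg_mul_sq_norm_add (V := E) (b := (1 / 2 : ℂ))
    (by norm_num) Complex.I t
  have hC : ((2 * Real.pi : ℝ) : ℂ) ^ ((Module.finrank ℝ E / 2 : ℝ) : ℂ) ≠ 0 := by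
    rw [← Complex.ofReal_cpow (by positivity)]
    exact_mod_cast (by positivity : ((2 * Real.pi) ^ (Module.finrank ℝ E / 2 : ℝ) : ℝ) ≠ 0)
  have key : ∀ x : E, (ENNReal.ofReal (stdGaussianPDFReal x)).toReal •
        Complex.exp (((inner ℝ x t : ℝ) : ℂ) * Complex.I)
      = (((2 * Real.pi : ℝ) : ℂ) ^ ((Module.finrank ℝ E / 2 : ℝ) : ℂ))⁻¹ *
        Complex.exp (-(1 / 2 : ℂ) * (‖x‖ : ℂ) ^ 2 + Complex.I * ((inner ℝ t x : ℝ) : ℂ)) := by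
    intro x
    rw [ENNReal.toReal_ofReal (stdGaussianPDFReal_nonneg x), stdGaussianPDFReal,
      Complex.real_smul, Complex.exp_add, real_inner_comm]
    push_cast [Complex.ofReal_cpow (show (0 : ℝ) ≤ 2 * Real.pi by positivity)]
    ring_nf
  simp_rw [key]
  rw [integral_const_mul, h]
  rw [show (Real.pi : ℂ) / (1 / 2) = ((2 * Real.pi : ℝ) : ℂ) by push_cast; ring,
    show ((Module.finrank ℝ E : ℂ) / 2) = ((Module.finrank ℝ E / 2 : ℝ) : ℂ) by push_cast; ring,
    ← mul_assoc, inv_mul_cancel₀ hC, one_mul, Complex.I_sq]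
  congr 1; ring

lemma stdGaussian_absolutelyContinuous : stdGaussian E ≪ volume := by
  rw [stdGaussian_eq_withDensity]; exact withDensity_absolutelyContinuous _ _

lemma integral_stdGaussian_eq (f : E → ℝ) :
    ∫ x, f x ∂(stdGaussian E) = ∫ x, stdGaussianPDFReal x * f x := by
  rw [stdGaussian_eq_withDensity, integral_withDensity_eq_integral_toReal_smul
    measurable_stdGaussianPDFReal.ennreal_ofReal (ae_of_all _ fun _ => ENNReal.ofReal_lt_top)]
  refine integral_congr_ae (ae_of_all _ fun x => ?_)
  simp only [ENNReal.toReal_ofReal (stdGaussianPDFReal_nonneg x), smul_eq_mul]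

/-- Change of variables under the dilation by `t`: the law of `t⁻¹ X` has density
`t^d exp (-(t² - 1) ‖x‖² / 2)` with respect to the law of `X`. -/
theorem integral_comp_inv_smul_stdGaussian (f : E → ℝ) {t : ℝ} (ht : 0 < t) :
    ∫ x, f (t⁻¹ • x) ∂(stdGaussian E)
      = ∫ x, t ^ Module.finrank ℝ E * Real.exp (-((t ^ 2 - 1) / 2) * ‖x‖ ^ 2) * f x
          ∂(stdGaussian E) := by
  rw [integral_stdGaussian_eq, integral_stdGaussian_eq]
  have h := Measure.integral_comp_smul (volume : Measure E)
    (fun y => stdGaussianPDFReal (t • y) * f y) t⁻¹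
  simp only [smul_smul, mul_inv_cancel₀ ht.ne', one_smul] at h
  rw [h, inv_pow, inv_inv, abs_of_pos (by positivity), smul_eq_mul, ← integral_const_mul]
  refine integral_congr_ae (ae_of_all _ fun x => ?_)
  simp only [stdGaussianPDFReal, norm_smul, Real.norm_eq_abs, abs_of_pos ht]
  rw [show -(1 / 2) * (t * ‖x‖) ^ 2 = -(1 / 2) * ‖x‖ ^ 2 + -((t ^ 2 - 1) / 2) * ‖x‖ ^ 2 by ring,
    Real.exp_add]
  ring

end Density

/-! ### Moments of the squared norm -/

lemma memLp_sq_gaussianReal : MemLp (fun x : ℝ => x ^ 2) 2 (gaussianReal 0 1) := by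
  have h := (memLp_id_gaussianReal' (μ := 0) (v := 1) 4 (by norm_num)).norm_rpow_div 2
  have e : (4 : ENNReal) / 2 = 2 := by
    rw [show (4 : ENNReal) = 2 * 2 by norm_num]
    exact ENNReal.mul_div_cancel_right (by norm_num) (by norm_num)
  rw [e] at h
  refine h.congr_norm (by fun_prop) (ae_of_all _ fun x => ?_)
  simp

lemma integral_sq_gaussianReal : ∫ x, x ^ 2 ∂(gaussianReal 0 1) = 1 := by
  have h := variance_fun_id_gaussianReal (μ := 0) (v := 1)
  rw [variance_eq_integral (by fun_prop)] at h
  simpa using h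

/-- The bound is lossy (the true value is `2`); it comes from `x ^ 4 / 4! ≤ exp x + exp (-x)`. -/
lemma variance_sq_gaussianReal_le : Var[fun x : ℝ => x ^ 2; gaussianReal 0 1] ≤ 96 := by
  refine (variance_le_expectation_sq (by fun_prop)).trans ?_
  have h1 := integrable_exp_mul_gaussianReal (μ := 0) (v := 1) 1
  have h2 := integrable_exp_mul_gaussianReal (μ := 0) (v := 1) (-1)
  have e1 := congrFun (mgf_fun_id_gaussianReal (μ := 0) (v := 1)) 1
  have e2 := congrFun (mgf_fun_id_gaussianReal (μ := 0) (v := 1)) (-1)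
  simp only [mgf] at e1 e2
  calc ∫ x, ((fun x : ℝ => x ^ 2) ^ 2) x ∂(gaussianReal 0 1)
      ≤ ∫ x, 24 * (Real.exp (1 * x) + Real.exp (-1 * x)) ∂(gaussianReal 0 1) := by
        refine integral_mono_of_nonneg (ae_of_all _ fun x => sq_nonneg _)
          ((h1.add h2).const_mul 24) (ae_of_all _ fun x => ?_)
        have a := Real.pow_div_factorial_le_exp |x| (abs_nonneg x) 4
        have b : Real.exp |x| ≤ Real.exp (1 * x) + Real.exp (-1 * x) := by
          rcases abs_cases x with ⟨h, -⟩ | ⟨h, -⟩ <;> rw [h] <;> simp [Real.exp_nonneg]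
        have c : |x| ^ 4 = x ^ 4 := by rw [show 4 = 2 * 2 by rfl, pow_mul, pow_mul, sq_abs]
        simp only [Pi.pow_apply]
        norm_num [Nat.factorial, c] at a
        nlinarith [a, b]
    _ = 24 * (Real.exp (1 / 2) + Real.exp (1 / 2)) := by
        rw [integral_const_mul, integral_add h1 h2, e1, e2]; norm_num
    _ ≤ 96 := by
        have : Real.exp (1 / 2) ≤ 2 := by
          rw [← Real.le_log_iff_exp_le (by norm_num)]
          linarith [Real.log_two_gt_d9]
        linarith

section Moments

variable {n : ℕ}

lemma integral_comp_norm_sq_stdGaussian (f : ℝ → ℝ) (hf : Measurable f) :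
    ∫ x, f (‖x‖ ^ 2) ∂(stdGaussian (EuclideanSpace ℝ (Fin n)))
      = ∫ x, f (∑ i, x i ^ 2) ∂(Measure.pi fun _ : Fin n => gaussianReal 0 1) := by
  rw [← map_pi_eq_stdGaussian, integral_map (by fun_prop)
    (Measurable.aestronglyMeasurable (by fun_prop))]
  simp_rw [EuclideanSpace.real_norm_sq_eq]

lemma memLp_sum_sq_pi : MemLp (fun x : Fin n → ℝ => ∑ i, x i ^ 2) 2
    (Measure.pi fun _ : Fin n => gaussianReal 0 1) := by
  refine memLp_finsetSum _ fun i _ => ?_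
  exact memLp_sq_gaussianReal.comp_measurePreserving
    (measurePreserving_eval (fun _ : Fin n => gaussianReal 0 1) i)

lemma memLp_norm_sq_stdGaussian : MemLp (fun x : EuclideanSpace ℝ (Fin n) => ‖x‖ ^ 2) 2
    (stdGaussian (EuclideanSpace ℝ (Fin n))) := by
  rw [← map_pi_eq_stdGaussian, memLp_map_measure_iff (Measurable.aestronglyMeasurable
    (by fun_prop)) (by fun_prop)]
  refine memLp_sum_sq_pi.congr_norm (Measurable.aestronglyMeasurable (by fun_prop))
    (ae_of_all _ fun x => ?_)
  simp [EuclideanSpace.real_norm_sq_eq]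

lemma integral_norm_sq_stdGaussian :
    ∫ x, ‖x‖ ^ 2 ∂(stdGaussian (EuclideanSpace ℝ (Fin n))) = n := by
  rw [integral_comp_norm_sq_stdGaussian (fun y => y) measurable_id, integral_finsetSum]
  · simp [integral_comp_eval (μ := fun _ : Fin n => gaussianReal 0 1)
      (f := fun x : ℝ => x ^ 2) (by fun_prop), integral_sq_gaussianReal]
  · intro i _
    exact (memLp_sq_gaussianReal.comp_measurePreserving
      (measurePreserving_eval (fun _ : Fin n => gaussianReal 0 1) i)).integrable (by norm_num)

lemma integral_norm_sq_sub_sq_stdGaussian_le :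
    ∫ x, ((n : ℝ) - ‖x‖ ^ 2) ^ 2 ∂(stdGaussian (EuclideanSpace ℝ (Fin n))) ≤ 96 * n := by
  have h : Var[∑ i : Fin n, fun x : Fin n → ℝ => x i ^ 2;
      Measure.pi fun _ : Fin n => gaussianReal 0 1] ≤ 96 * n := by
    rw [variance_sum_pi (X := fun (_ : Fin n) (y : ℝ) => y ^ 2) fun _ => memLp_sq_gaussianReal]
    refine (Finset.sum_le_sum fun i _ => variance_sq_gaussianReal_le).trans ?_
    simp [mul_comm]
  have e : (∑ i : Fin n, fun x : Fin n → ℝ => x i ^ 2) = fun x => ∑ i, x i ^ 2 := by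
    ext x; simp
  rw [e, variance_eq_integral (Measurable.aemeasurable (by fun_prop))] at h
  have m := integral_norm_sq_stdGaussian (n := n)
  rw [integral_comp_norm_sq_stdGaussian (fun y => y) measurable_id] at m
  rw [m] at h
  rw [integral_comp_norm_sq_stdGaussian (fun y => ((n : ℝ) - y) ^ 2) (by fun_prop)]
  convert h using 3
  ring

lemma integrable_norm_sq_stdGaussian : Integrable (fun x : EuclideanSpace ℝ (Fin n) => ‖x‖ ^ 2)
    (stdGaussian (EuclideanSpace ℝ (Fin n))) :=
  memLp_norm_sq_stdGaussian.integrable (by norm_num)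

/-- The derivative at `t = 1` of the volume of `t • L` is the integral of `n - ‖x‖²` over `L`. This
is the finite form of that fact: convexity of `exp` turns it into an inequality with an explicit
error, so that no limit has to be taken. -/
theorem mul_setIntegral_le_dilation_sub {L : Set (EuclideanSpace ℝ (Fin n))}
    (hL : MeasurableSet L) {h : ℝ} (hh : 0 ≤ h) :
    h * ∫ x in L, ((n : ℝ) - ‖x‖ ^ 2) ∂(stdGaussian (EuclideanSpace ℝ (Fin n)))
      ≤ (stdGaussian (EuclideanSpace ℝ (Fin n))).real {x | (1 + h)⁻¹ • x ∈ L}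
        - (stdGaussian (EuclideanSpace ℝ (Fin n))).real L + h ^ 2 * n := by
  set γ := stdGaussian (EuclideanSpace ℝ (Fin n))
  have ht : 0 < 1 + h := by linarith
  have hN := integrable_norm_sq_stdGaussian (n := n)
  have hI : Integrable (fun x : EuclideanSpace ℝ (Fin n) => (n : ℝ) - ‖x‖ ^ 2) γ :=
    (integrable_const _).sub hN
  have hJ : Integrable (fun x : EuclideanSpace ℝ (Fin n) => (n : ℝ) + ‖x‖ ^ 2) γ :=
    (integrable_const _).add hN
  have hD : Integrable (fun x : EuclideanSpace ℝ (Fin n) =>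
      h * ((n : ℝ) - ‖x‖ ^ 2) - h ^ 2 / 2 * ((n : ℝ) + ‖x‖ ^ 2)) γ :=
    (hI.const_mul h).sub (hJ.const_mul (h ^ 2 / 2))
  have hdil : γ.real {x | (1 + h)⁻¹ • x ∈ L} = ∫ x in L, (1 + h) ^ n *
      Real.exp (-(((1 + h) ^ 2 - 1) / 2) * ‖x‖ ^ 2) ∂γ := by
    have hm : MeasurableSet {x : EuclideanSpace ℝ (Fin n) | (1 + h)⁻¹ • x ∈ L} :=
      (measurable_const_smul _) hL
    have e := integral_comp_inv_smul_stdGaussian (E := EuclideanSpace ℝ (Fin n))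
      (L.indicator fun _ => (1 : ℝ)) ht
    rw [← integral_indicator_one hm, ← integral_indicator hL]
    refine Eq.trans ?_ (e.trans ?_)
    · rfl
    · refine integral_congr_ae (ae_of_all _ fun x => ?_)
      by_cases hx : x ∈ L <;> simp [hx]
  have hexp : Integrable (fun x : EuclideanSpace ℝ (Fin n) => (1 + h) ^ n *
      Real.exp (-(((1 + h) ^ 2 - 1) / 2) * ‖x‖ ^ 2)) γ := by
    refine Integrable.of_bound (C := (1 + h) ^ n) (Measurable.aestronglyMeasurable (by fun_prop))
      (ae_of_all _ fun x => ?_)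
    rw [Real.norm_of_nonneg (by positivity)]
    refine mul_le_of_le_one_right (by positivity) (Real.exp_le_one_iff.2 ?_)
    nlinarith [sq_nonneg ‖x‖, mul_nonneg hh (sq_nonneg ‖x‖), mul_nonneg (mul_nonneg hh hh)
      (sq_nonneg ‖x‖)]
  have hlog : h - h ^ 2 / 2 ≤ Real.log (1 + h) := by
    refine le_trans ?_ (Real.le_log_one_add_of_nonneg hh)
    rw [le_div_iff₀ (by linarith)]
    nlinarith [pow_nonneg hh 3]
  have hpt : ∀ x : EuclideanSpace ℝ (Fin n),
      1 + (h * ((n : ℝ) - ‖x‖ ^ 2) - h ^ 2 / 2 * ((n : ℝ) + ‖x‖ ^ 2)) ≤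
        (1 + h) ^ n * Real.exp (-(((1 + h) ^ 2 - 1) / 2) * ‖x‖ ^ 2) := by
    intro x
    have e : (1 + h) ^ n = Real.exp (n * Real.log (1 + h)) := by
      rw [Real.exp_nat_mul, Real.exp_log ht]
    rw [e, ← Real.exp_add]
    refine le_trans ?_ (Real.add_one_le_exp _)
    have := mul_le_mul_of_nonneg_left hlog (Nat.cast_nonneg (α := ℝ) n)
    nlinarith
  have hmono := setIntegral_mono (s := L) (μ := γ)
    ((integrable_const (1 : ℝ)).add hD).integrableOn hexp.integrableOn hpt
  have hle : ∫ x in L, ((n : ℝ) + ‖x‖ ^ 2) ∂γ ≤ 2 * n := by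
    refine (setIntegral_le_integral hJ (ae_of_all _ fun x => by positivity)).trans ?_
    rw [integral_add (integrable_const _) hN, integral_norm_sq_stdGaussian]
    simp [two_mul]
  rw [← hdil] at hmono
  have hsplit : ∫ x in L, (1 + (h * ((n : ℝ) - ‖x‖ ^ 2) - h ^ 2 / 2 * ((n : ℝ) + ‖x‖ ^ 2))) ∂γ
      = γ.real L + (h * ∫ x in L, ((n : ℝ) - ‖x‖ ^ 2) ∂γ
        - h ^ 2 / 2 * ∫ x in L, ((n : ℝ) + ‖x‖ ^ 2) ∂γ) := by
    rw [integral_add (integrable_const _) hD.integrableOn,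
      integral_sub (hI.const_mul h).integrableOn (hJ.const_mul (h ^ 2 / 2)).integrableOn,
      integral_const_mul, integral_const_mul]
    simp
  have := mul_le_mul_of_nonneg_left hle (by positivity : 0 ≤ h ^ 2 / 2)
  have hmono' := hsplit.symm.le.trans hmono
  linarith

end Moments

/-! ### Gaussian measure of sets that are closed under translation in one direction -/

section Push

variable {E : Type*} [NormedAddCommGroup E] [InnerProductSpace ℝ E]

lemma inner_resample {v : E} (hv : ‖v‖ = 1) (z : E) (y : ℝ) :
    inner ℝ (z + (y - inner ℝ z v) • v) v = y := by
  rw [inner_add_left, real_inner_smul_left, real_inner_self_eq_norm_sq, hv]; ring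

variable [FiniteDimensional ℝ E] [MeasurableSpace E] [BorelSpace E]

/-- Resampling the coordinate in a unit direction `v` with an independent standard normal variable
preserves the standard Gaussian. -/
theorem map_resample_stdGaussian {v : E} (hv : ‖v‖ = 1) :
    ((stdGaussian E).prod (gaussianReal 0 1)).map
      (fun p => p.1 + (p.2 - inner ℝ p.1 v) • v) = stdGaussian E := by
  have hvv : inner ℝ v v = (1 : ℝ) := by rw [real_inner_self_eq_norm_sq, hv, one_pow]
  have hm : Measurable fun p : E × ℝ => p.1 + (p.2 - inner ℝ p.1 v) • v := by fun_prop
  have := Measure.isProbabilityMeasure_map (μ := (stdGaussian E).prod (gaussianReal 0 1))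
    hm.aemeasurable
  refine Measure.ext_of_charFun ?_
  ext t
  rw [charFun_apply, integral_map hm.aemeasurable (Measurable.aestronglyMeasurable (by fun_prop)),
    charFun_stdGaussian]
  have key : ∀ p : E × ℝ,
      Complex.exp (((inner ℝ (p.1 + (p.2 - inner ℝ p.1 v) • v) t : ℝ) : ℂ) * Complex.I)
      = Complex.exp (((inner ℝ p.1 (t - (inner ℝ v t : ℝ) • v) : ℝ) : ℂ) * Complex.I)
        * Complex.exp (((inner ℝ v t : ℝ) : ℂ) * (p.2 : ℂ) * Complex.I) := by
    intro p
    rw [← Complex.exp_add, inner_add_left, inner_sub_right, real_inner_smul_left,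
      real_inner_smul_right]
    congr 1; push_cast; ring
  simp_rw [key]
  rw [integral_prod_mul (fun x : E => Complex.exp
      (((inner ℝ x (t - (inner ℝ v t : ℝ) • v) : ℝ) : ℂ) * Complex.I))
      (fun y : ℝ => Complex.exp (((inner ℝ v t : ℝ) : ℂ) * (y : ℂ) * Complex.I)),
    ← charFun_apply, ← charFun_apply_real, charFun_stdGaussian, charFun_gaussianReal,
    ← Complex.exp_add]
  have hn : ‖t - (inner ℝ v t : ℝ) • v‖ ^ 2 = ‖t‖ ^ 2 - (inner ℝ v t) ^ 2 := by
    rw [norm_sub_sq_real, norm_smul, hv, real_inner_smul_right, real_inner_comm, mul_one,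
      Real.norm_eq_abs, sq_abs]; ring
  rw [← Complex.ofReal_pow ‖t - _‖ 2, hn]
  congr 1; push_cast; ring

lemma stdGaussian_apply_eq_lintegral_slice {v : E} (hv : ‖v‖ = 1) {B : Set E}
    (hB : MeasurableSet B) :
    stdGaussian E B = ∫⁻ z, gaussianReal 0 1 {y | z + (y - inner ℝ z v) • v ∈ B}
      ∂(stdGaussian E) := by
  have hm : Measurable fun p : E × ℝ => p.1 + (p.2 - inner ℝ p.1 v) • v := by fun_prop
  conv_lhs => rw [← map_resample_stdGaussian hv, Measure.map_apply hm hB,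
    Measure.prod_apply (hm hB)]
  rfl

lemma measurableSet_slab (v : E) (S : Set ℝ) (hS : MeasurableSet S) :
    MeasurableSet {x : E | inner ℝ x v ∈ S} :=
  (show Measurable fun x : E => (inner ℝ x v : ℝ) by fun_prop) hS

/-- The law of `⟨X, v⟩` is standard normal. -/
lemma stdGaussian_slab {v : E} (hv : ‖v‖ = 1) {S : Set ℝ} (hS : MeasurableSet S) :
    stdGaussian E {x | inner ℝ x v ∈ S} = gaussianReal 0 1 S := by
  rw [stdGaussian_apply_eq_lintegral_slice hv (measurableSet_slab v S hS)]
  simp only [Set.mem_ofPred_eq, inner_resample hv, Set.ofPred_mem_eq, lintegral_const, measure_univ,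
    mul_one]

/-- If `A` is closed under translation by nonnegative multiples of `v`, then every line in the
direction `v` that meets `A` in the slab `a < ⟨x, v⟩ ≤ b` stays in `A` beyond it; hence the part of
`A` in the slab is controlled by the part of `A` beyond the slab. -/
theorem stdGaussian_slab_inter_mul_le {v : E} (hv : ‖v‖ = 1) {A : Set E} (hA : MeasurableSet A)
    (hup : ∀ x ∈ A, ∀ s : ℝ, 0 ≤ s → x + s • v ∈ A) (a b : ℝ) :
    (stdGaussian E).real (A ∩ {x | inner ℝ x v ∈ Set.Ioc a b}) * (gaussianReal 0 1).real (Set.Ioi b)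
      ≤ (gaussianReal 0 1).real (Set.Ioc a b) * (stdGaussian E).real A := by
  have measurable_slice : ∀ {B : Set E}, MeasurableSet B →
      Measurable fun z : E => gaussianReal 0 1 {y | z + (y - inner ℝ z v) • v ∈ B} := fun hB =>
    measurable_measure_prodMk_left ((show Measurable fun p : E × ℝ =>
      p.1 + (p.2 - inner ℝ p.1 v) • v by fun_prop) hB)
  have hA' := hA.inter (measurableSet_slab v (Set.Ioc a b) measurableSet_Ioc)
  have main : stdGaussian E (A ∩ {x | inner ℝ x v ∈ Set.Ioc a b}) * gaussianReal 0 1 (Set.Ioi b)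
      ≤ gaussianReal 0 1 (Set.Ioc a b) * stdGaussian E A := by
    rw [stdGaussian_apply_eq_lintegral_slice hv hA', stdGaussian_apply_eq_lintegral_slice hv hA,
      ← lintegral_mul_const _ (measurable_slice hA'), ← lintegral_const_mul _ (measurable_slice hA)]
    refine lintegral_mono fun z => ?_
    simp only [Set.mem_inter_iff, Set.mem_ofPred_eq, inner_resample hv]
    rcases Set.eq_empty_or_nonempty
      {y : ℝ | z + (y - inner ℝ z v) • v ∈ A ∧ y ∈ Set.Ioc a b} with h | ⟨y₀, hy₀, hy₀'⟩
    · rw [h]; simp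
    · refine mul_le_mul' (measure_mono fun y hy => hy.2) (measure_mono fun y hy => ?_)
      have := hup _ hy₀ (y - y₀) (by linarith [Set.mem_Ioi.1 hy, hy₀'.2])
      rw [add_assoc, ← add_smul] at this
      simpa [show y₀ - inner ℝ z v + (y - y₀) = y - inner ℝ z v by ring] using this
  have := ENNReal.toReal_mono (by finiteness) main
  rwa [ENNReal.toReal_mul, ENNReal.toReal_mul] at this

end Push

/-! ### One-dimensional Gaussian estimates -/

lemma gaussianPDFReal_zero_one (x : ℝ) :
    gaussianPDFReal 0 1 x = (Real.sqrt (2 * Real.pi))⁻¹ * Real.exp (-x ^ 2 / 2) := by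
  simp [gaussianPDFReal]

lemma gaussianPDFReal_zero_one_anti {x y : ℝ} (hx : 0 ≤ x) (hxy : x ≤ y) :
    gaussianPDFReal 0 1 y ≤ gaussianPDFReal 0 1 x := by
  rw [gaussianPDFReal_zero_one, gaussianPDFReal_zero_one]
  gcongr

lemma gaussianReal_real_eq_integral (S : Set ℝ) :
    (gaussianReal 0 1).real S = ∫ x in S, gaussianPDFReal 0 1 x := by
  rw [measureReal_def, gaussianReal_apply_eq_integral 0 one_ne_zero, ENNReal.toReal_ofReal]
  exact integral_nonneg fun x => gaussianPDFReal_nonneg _ _ x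

lemma gaussianReal_Ioc_le {a b : ℝ} (ha : 0 ≤ a) (hab : a ≤ b) :
    (gaussianReal 0 1).real (Set.Ioc a b) ≤ (b - a) * gaussianPDFReal 0 1 a := by
  rw [gaussianReal_real_eq_integral]
  have := setIntegral_mono_on (μ := volume) (s := Set.Ioc a b)
    (integrable_gaussianPDFReal 0 1).integrableOn
    (integrableOn_const (C := gaussianPDFReal 0 1 a) (by simp)) measurableSet_Ioc
    fun x hx => gaussianPDFReal_zero_one_anti ha hx.1.le
  simpa [hab] using this

lemma le_gaussianReal_Ioc {a b : ℝ} (ha : 0 ≤ a) (hab : a ≤ b) :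
    (b - a) * gaussianPDFReal 0 1 b ≤ (gaussianReal 0 1).real (Set.Ioc a b) := by
  rw [gaussianReal_real_eq_integral]
  have := setIntegral_mono_on (μ := volume) (s := Set.Ioc a b)
    (integrableOn_const (C := gaussianPDFReal 0 1 b) (by simp))
    (integrable_gaussianPDFReal 0 1).integrableOn measurableSet_Ioc
    fun x hx => gaussianPDFReal_zero_one_anti (ha.trans hx.1.le) hx.2
  simpa [hab] using this

/-- A thin interval `(θ, (1 + h) θ]` with `θ ≤ T` carries at most a fraction `O(h T (1 + T))` of the
mass beyond it: the hazard rate of the normal distribution at `θ` is `O(1 + θ)`. -/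
lemma gaussianReal_Ioc_le_mul_Ioi {θ T h : ℝ} (hθ : 0 < θ) (hT : θ ≤ T) (hh : 0 ≤ h)
    (hhT : h * (T * (1 + T)) ≤ 1) :
    (gaussianReal 0 1).real (Set.Ioc θ ((1 + h) * θ)) ≤
      h * (T * (1 + T)) * Real.exp 4 * (gaussianReal 0 1).real (Set.Ioi ((1 + h) * θ)) := by
  have hT0 : 0 < T := hθ.trans_le hT
  set w := 1 / (1 + T) with hw
  have hw0 : 0 < w := by positivity
  have hw1 : w * (1 + T) = 1 := by rw [hw]; field_simp
  have hhw : h * θ ≤ w := by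
    rw [hw, le_div_iff₀ (by linarith)]
    nlinarith [mul_le_mul_of_nonneg_left hT (mul_nonneg hh (by linarith : 0 ≤ 1 + T))]
  have hb : θ ≤ (1 + h) * θ := by nlinarith
  have h1 := gaussianReal_Ioc_le hθ.le hb
  have h2 := le_gaussianReal_Ioc (a := (1 + h) * θ) (b := (1 + h) * θ + w) (by positivity)
    (by linarith)
  have h3 : (gaussianReal 0 1).real (Set.Ioc ((1 + h) * θ) ((1 + h) * θ + w)) ≤
      (gaussianReal 0 1).real (Set.Ioi ((1 + h) * θ)) :=
    measureReal_mono Set.Ioc_subset_Ioi_self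
  have h4 : gaussianPDFReal 0 1 θ ≤ Real.exp 4 * gaussianPDFReal 0 1 ((1 + h) * θ + w) := by
    rw [gaussianPDFReal_zero_one, gaussianPDFReal_zero_one, mul_left_comm, ← Real.exp_add]
    gcongr
    have e1 : (1 + h) * θ + w ≤ θ + 2 * w := by linarith
    have e2 : ((1 + h) * θ + w) ^ 2 ≤ (θ + 2 * w) ^ 2 := by gcongr
    have e3 : θ * w ≤ 1 := by nlinarith
    have e4 : w * w ≤ 1 := by nlinarith
    nlinarith
  have hcoef : 0 ≤ h * θ * Real.exp 4 * (1 + T) := by positivity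
  calc _ ≤ ((1 + h) * θ - θ) * gaussianPDFReal 0 1 θ := h1
    _ = h * θ * gaussianPDFReal 0 1 θ := by ring
    _ ≤ h * θ * (Real.exp 4 * gaussianPDFReal 0 1 ((1 + h) * θ + w)) := by gcongr
    _ = h * θ * Real.exp 4 * (1 + T) *
        (((1 + h) * θ + w - (1 + h) * θ) * gaussianPDFReal 0 1 ((1 + h) * θ + w)) := by
        rw [add_sub_cancel_left]
        linear_combination (-(h * θ * Real.exp 4 * gaussianPDFReal 0 1 ((1 + h) * θ + w))) * hw1
    _ ≤ h * θ * Real.exp 4 * (1 + T) * (gaussianReal 0 1).real (Set.Ioi ((1 + h) * θ)) := by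
        gcongr; exact h2.trans h3
    _ ≤ h * T * Real.exp 4 * (1 + T) * (gaussianReal 0 1).real (Set.Ioi ((1 + h) * θ)) := by
        gcongr
    _ = _ := by ring

lemma gaussianReal_Ioc_le_exp {θ T h : ℝ} (hT : 0 ≤ T) (hθ : T ≤ θ) (hh : 0 ≤ h) :
    (gaussianReal 0 1).real (Set.Ioc θ ((1 + h) * θ)) ≤ h * Real.exp (-T ^ 2 / 4) := by
  have hθ0 : 0 ≤ θ := hT.trans hθ
  have h1 := gaussianReal_Ioc_le hθ0 (by nlinarith : θ ≤ (1 + h) * θ)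
  have h2 : gaussianPDFReal 0 1 θ ≤ Real.exp (-θ ^ 2 / 2) := by
    rw [gaussianPDFReal_zero_one]
    refine mul_le_of_le_one_left (Real.exp_nonneg _) (inv_le_one_of_one_le₀ ?_)
    rw [Real.one_le_sqrt]
    linarith [Real.pi_gt_three]
  have h3 : θ ≤ Real.exp (θ ^ 2 / 4) := by
    nlinarith [Real.add_one_le_exp (θ ^ 2 / 4), sq_nonneg (θ - 2)]
  calc _ ≤ ((1 + h) * θ - θ) * gaussianPDFReal 0 1 θ := h1
    _ = h * (θ * gaussianPDFReal 0 1 θ) := by ring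
    _ ≤ h * (Real.exp (θ ^ 2 / 4) * Real.exp (-θ ^ 2 / 2)) := by
        have := gaussianPDFReal_nonneg 0 1 θ
        gcongr
    _ = h * Real.exp (-θ ^ 2 / 4) := by rw [← Real.exp_add]; congr 2; ring
    _ ≤ h * Real.exp (-T ^ 2 / 4) := by gcongr

/-! ### Anticoncentration for intersections of halfspaces -/

section Halfspaces

variable {E : Type*} [NormedAddCommGroup E] [InnerProductSpace ℝ E]

/-- The region where the `i`-th of the constraints `⟨x, v j⟩ ≤ θ j` is the most violated one (or the
least slack one); ties go to the least index, so that the regions are pairwise disjoint. -/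
def tightestRegion {M : ℕ} (v : Fin M → E) (θ : Fin M → ℝ) (i : Fin M) : Set E :=
  {x | ∀ j, inner ℝ x (v j) - θ j ≤ inner ℝ x (v i) - θ i ∧
    (j < i → inner ℝ x (v j) - θ j < inner ℝ x (v i) - θ i)}

variable {M : ℕ} (v : Fin M → E) (θ : Fin M → ℝ)

lemma pairwise_disjoint_tightestRegion :
    Pairwise (Function.onFun Disjoint (tightestRegion v θ)) := by
  intro i j hij
  refine Set.disjoint_left.2 fun x hi hj => ?_
  rcases lt_or_gt_of_ne hij with h | h
  · exact absurd (hi j).1 (not_le.2 ((hj i).2 h))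
  · exact absurd (hj i).1 (not_le.2 ((hi j).2 h))

lemma exists_mem_tightestRegion [NeZero M] (x : E) : ∃ i, x ∈ tightestRegion v θ i := by
  obtain ⟨k, hk⟩ := Finite.exists_max fun j => inner ℝ x (v j) - θ j
  obtain ⟨i, hi, hmin⟩ := WellFounded.has_min (wellFounded_lt (α := Fin M))
    {i | ∀ j, inner ℝ x (v j) - θ j ≤ inner ℝ x (v i) - θ i} ⟨k, hk⟩
  refine ⟨i, fun j => ⟨hi j, fun hj => lt_of_le_of_ne (hi j) fun e => ?_⟩⟩
  exact hmin j (fun l => (hi l).trans e.ge) hj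

lemma tightestRegion_add_smul (hv : ∀ i, ‖v i‖ = 1) (i : Fin M) :
    ∀ x ∈ tightestRegion v θ i, ∀ s : ℝ, 0 ≤ s → x + s • v i ∈ tightestRegion v θ i := by
  intro x hx s hs j
  have h1 : inner ℝ (v i) (v j) ≤ (1 : ℝ) := by
    simpa [hv] using real_inner_le_norm (v i) (v j)
  have h2 : inner ℝ (v i) (v i) = (1 : ℝ) := by rw [real_inner_self_eq_norm_sq, hv, one_pow]
  have h3 := mul_le_mul_of_nonneg_left h1 hs
  simp only [inner_add_left, real_inner_smul_left, h2]
  exact ⟨by linarith [(hx j).1], fun hj => by linarith [(hx j).2 hj]⟩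

variable [MeasurableSpace E] [BorelSpace E] [FiniteDimensional ℝ E]

lemma measurableSet_tightestRegion (i : Fin M) : MeasurableSet (tightestRegion v θ i) := by
  have hm : ∀ j, Measurable fun x : E => inner ℝ x (v j) - θ j := fun j => by fun_prop
  unfold tightestRegion
  simp only [Set.ofPred_forall, Set.ofPred_and]
  exact MeasurableSet.iInter fun j => (measurableSet_le (hm j) (hm i)).inter
    (MeasurableSet.iInter fun _ => measurableSet_lt (hm j) (hm i))

/-- A Nazarov-type bound: dilating an intersection of `M` halfspaces by `1 + h` adds volume at most
of order `h log M` (take `T² = 4 log M`). A point of `(1 + h) L` outside `L` violates its tightest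
constraint `i`, so it lies in the slab `θ i < ⟨x, v i⟩ ≤ (1 + h) θ i`. For `θ i ≤ T` the slab is
compared with the whole region `tightestRegion v θ i`, and these are disjoint; the `M` slabs with
`θ i > T` are negligible. -/
theorem stdGaussian_dilation_sub_le (hv : ∀ i, ‖v i‖ = 1) {T h : ℝ} (hT : 0 ≤ T) (hh : 0 ≤ h)
    (hhT : h * (T * (1 + T)) ≤ 1) :
    (stdGaussian E).real {x | (1 + h)⁻¹ • x ∈ ⋂ i, {x | inner ℝ x (v i) ≤ θ i}}
      - (stdGaussian E).real (⋂ i, {x | inner ℝ x (v i) ≤ θ i})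
      ≤ h * (T * (1 + T) * Real.exp 4 + M * Real.exp (-T ^ 2 / 4)) := by
  set γ := stdGaussian E
  set L : Set E := ⋂ i, {x | inner ℝ x (v i) ≤ θ i}
  let A := tightestRegion v θ
  let S : Fin M → Set E := fun i => A i ∩ {x | inner ℝ x (v i) ∈ Set.Ioc (θ i) ((1 + h) * θ i)}
  have ht : 0 < 1 + h := by linarith
  have hsub : {x | (1 + h)⁻¹ • x ∈ L} ⊆ L ∪ ⋃ i, S i := by
    intro x hx
    by_cases hxL : x ∈ L
    · exact Or.inl hxL
    · right
      have hx' : ∀ i, inner ℝ x (v i) ≤ (1 + h) * θ i := by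
        intro i
        have := Set.mem_iInter.1 hx i
        rw [Set.mem_ofPred_eq, real_inner_smul_left, inv_mul_le_iff₀ ht] at this
        exact this
      obtain ⟨k, hk⟩ : ∃ k, θ k < inner ℝ x (v k) := by
        by_contra! hc
        exact hxL (Set.mem_iInter.2 hc)
      have : NeZero M := ⟨fun e => (e ▸ k).elim0⟩
      obtain ⟨i, hi⟩ := exists_mem_tightestRegion v θ x
      exact Set.mem_iUnion.2 ⟨i, hi, by linarith [(hi k).1], hx' i⟩
  have hS : ∀ i, γ.real (S i) ≤
      h * (T * (1 + T)) * Real.exp 4 * γ.real (A i) + h * Real.exp (-T ^ 2 / 4) := by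
    intro i
    have p1 : 0 ≤ h * (T * (1 + T)) * Real.exp 4 * γ.real (A i) := by positivity
    have p2 : 0 ≤ h * Real.exp (-T ^ 2 / 4) := by positivity
    rcases le_or_gt (θ i) 0 with h0 | h0
    · have : S i = ∅ := by
        refine Set.eq_empty_of_forall_notMem fun x hx => ?_
        have := hx.2.1.trans_le hx.2.2
        nlinarith
      rw [this]; simp only [measureReal_empty]; positivity
    rcases le_or_gt (θ i) T with hi | hi
    · have a1 := stdGaussian_slab_inter_mul_le (hv i) (measurableSet_tightestRegion v θ i)
        (tightestRegion_add_smul v θ hv i) (θ i) ((1 + h) * θ i)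
      have a2 := gaussianReal_Ioc_le_mul_Ioi h0 hi hh hhT
      have a3 : 0 < (gaussianReal 0 1).real (Set.Ioi ((1 + h) * θ i)) := by
        have := le_gaussianReal_Ioc (a := (1 + h) * θ i) (b := (1 + h) * θ i + 1) (by positivity)
          (by linarith)
        have q := gaussianPDFReal_pos 0 1 ((1 + h) * θ i + 1) one_ne_zero
        have r : (gaussianReal 0 1).real (Set.Ioc ((1 + h) * θ i) ((1 + h) * θ i + 1)) ≤
          (gaussianReal 0 1).real (Set.Ioi ((1 + h) * θ i)) :=
            measureReal_mono Set.Ioc_subset_Ioi_self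
        linarith
      have a4 := a1.trans (mul_le_mul_of_nonneg_right a2 (measureReal_nonneg (s := A i)))
      have a5 : γ.real (S i) ≤ h * (T * (1 + T)) * Real.exp 4 * γ.real (A i) := by
        refine le_of_mul_le_mul_right (a4.trans_eq ?_) a3
        ring
      linarith
    · have b1 : γ.real (S i) ≤ γ.real {x | inner ℝ x (v i) ∈ Set.Ioc (θ i) ((1 + h) * θ i)} :=
        measureReal_mono Set.inter_subset_right
      have b2 : γ.real {x | inner ℝ x (v i) ∈ Set.Ioc (θ i) ((1 + h) * θ i)} =
          (gaussianReal 0 1).real (Set.Ioc (θ i) ((1 + h) * θ i)) := by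
        rw [measureReal_def, stdGaussian_slab (hv i) measurableSet_Ioc, measureReal_def]
      have b3 := gaussianReal_Ioc_le_exp hT hi.le hh
      linarith
  have hA1 : ∑ i, γ.real (A i) ≤ 1 := by
    have := measureReal_iUnion_fintype (μ := γ) (pairwise_disjoint_tightestRegion v θ)
      (measurableSet_tightestRegion v θ)
    rw [← this]
    exact measureReal_le_one
  have hU : γ.real {x | (1 + h)⁻¹ • x ∈ L} ≤ γ.real L + ∑ i, γ.real (S i) :=
    (measureReal_mono hsub).trans ((measureReal_union_le _ _).trans
      (by gcongr; exact measureReal_iUnion_fintype_le _))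
  have hsum := Finset.sum_le_sum fun i (_ : i ∈ Finset.univ) => hS i
  rw [Finset.sum_add_distrib, ← Finset.mul_sum] at hsum
  have hc : 0 ≤ h * (T * (1 + T)) * Real.exp 4 := by positivity
  have := mul_le_mul_of_nonneg_left hA1 hc
  simp only [Finset.sum_const, Finset.card_univ, Fintype.card_fin, nsmul_eq_mul] at hsum
  linarith

end Halfspaces

/-! ### Total convex influence and Gaussian distance -/

section Influence

variable {n : ℕ} {K L : Set (EuclideanSpace ℝ (Fin n))}

lemma nullMeasurableSet_stdGaussian_of_convex (hK : Convex ℝ K) :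
    NullMeasurableSet K (stdGaussian (EuclideanSpace ℝ (Fin n))) :=
  (hK.nullMeasurableSet volume).mono_ac stdGaussian_absolutelyContinuous

lemma totalConvexInfluence_eq_setIntegral
    (hK : NullMeasurableSet K (stdGaussian (EuclideanSpace ℝ (Fin n)))) :
    totalConvexInfluence K
      = ∫ x in K, ((n : ℝ) - ‖x‖ ^ 2) ∂(stdGaussian (EuclideanSpace ℝ (Fin n))) := by
  have hi : ∀ i : Fin n, Integrable (fun x : EuclideanSpace ℝ (Fin n) => 1 - x i ^ 2)
      (stdGaussian (EuclideanSpace ℝ (Fin n))) := by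
    intro i
    refine (integrable_const _).sub ?_
    refine integrable_norm_sq_stdGaussian.mono' (Measurable.aestronglyMeasurable (by fun_prop))
      (ae_of_all _ fun x => ?_)
    rw [Real.norm_of_nonneg (sq_nonneg _), EuclideanSpace.real_norm_sq_eq]
    exact Finset.single_le_sum (f := fun j => x j ^ 2) (fun j _ => sq_nonneg _) (Finset.mem_univ i)
  have h1 : ∀ i : Fin n, convexInfluence (EuclideanSpace.single i (1 : ℝ)) K
      = ∫ x in K, (1 - x i ^ 2) ∂(stdGaussian (EuclideanSpace ℝ (Fin n))) := by
    intro i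
    rw [convexInfluence, ← integral_indicator₀ hK]
    refine integral_congr_ae (ae_of_all _ fun x => ?_)
    by_cases hx : x ∈ K <;> simp [hx, EuclideanSpace.inner_single_right]
  rw [totalConvexInfluence, Finset.sum_congr rfl fun i _ => h1 i,
    ← integral_finsetSum _ fun i _ => (hi i).integrableOn]
  refine integral_congr_ae (ae_of_all _ fun x => ?_)
  simp [EuclideanSpace.real_norm_sq_eq]

/-- The total convex influence is stable under small changes of the set. This is Cauchy-Schwarz for
`∫ 1_{K ∆ L} (n - ‖x‖²)`, in the form of the AM-GM inequality with a free parameter `a`. -/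
theorem totalConvexInfluence_sub_le
    (hK : NullMeasurableSet K (stdGaussian (EuclideanSpace ℝ (Fin n))))
    (hL : NullMeasurableSet L (stdGaussian (EuclideanSpace ℝ (Fin n)))) {a : ℝ} (ha : 0 < a) :
    totalConvexInfluence K - totalConvexInfluence L
      ≤ a / 2 * gaussianDist K L + 1 / (2 * a) * (96 * n) := by
  set γ := stdGaussian (EuclideanSpace ℝ (Fin n))
  have hq : MemLp (fun x : EuclideanSpace ℝ (Fin n) => (n : ℝ) - ‖x‖ ^ 2) 2 γ :=
    (memLp_const _).sub memLp_norm_sq_stdGaussian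
  have hq1 := hq.integrable (by norm_num)
  have hD : NullMeasurableSet (symmDiff K L) γ := (hK.diff hL).union (hL.diff hK)
  rw [totalConvexInfluence_eq_setIntegral hK, totalConvexInfluence_eq_setIntegral hL,
    ← integral_indicator₀ hK, ← integral_indicator₀ hL,
    ← integral_sub (hq1.indicator₀ hK) (hq1.indicator₀ hL)]
  have hr : Integrable (fun x => a / 2 * (symmDiff K L).indicator (fun _ => (1 : ℝ)) x) γ :=
    ((integrable_const _).indicator₀ hD).const_mul _
  have hs : Integrable (fun x : EuclideanSpace ℝ (Fin n) =>
      1 / (2 * a) * ((n : ℝ) - ‖x‖ ^ 2) ^ 2) γ := hq.integrable_sq.const_mul _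
  calc _ ≤ ∫ x, (a / 2 * (symmDiff K L).indicator (fun _ => (1 : ℝ)) x
          + 1 / (2 * a) * ((n : ℝ) - ‖x‖ ^ 2) ^ 2) ∂γ := by
        refine integral_mono ((hq1.indicator₀ hK).sub (hq1.indicator₀ hL)) (hr.add hs)
          fun x => ?_
        have amgm : ∀ q : ℝ, q ≤ a / 2 * 1 + 1 / (2 * a) * q ^ 2 := by
          intro q
          have : a / 2 * 1 + 1 / (2 * a) * q ^ 2 - q = (q - a) ^ 2 / (2 * a) := by
            field_simp; ring
          have : 0 ≤ (q - a) ^ 2 / (2 * a) := by positivity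
          linarith
        have pos : 0 ≤ 1 / (2 * a) * ((n : ℝ) - ‖x‖ ^ 2) ^ 2 := by positivity
        have p1 := amgm ((n : ℝ) - ‖x‖ ^ 2)
        have p2 := amgm (-((n : ℝ) - ‖x‖ ^ 2))
        rw [neg_sq] at p2
        by_cases h1 : x ∈ K <;> by_cases h2 : x ∈ L <;>
          simp only [Set.indicator, Set.mem_symmDiff, h1, h2, not_true_eq_false, not_false_eq_true,
            and_true, and_false, or_false, or_true, if_true, if_false] <;> linarith
    _ = a / 2 * gaussianDist K L + 1 / (2 * a) *
          ∫ x, ((n : ℝ) - ‖x‖ ^ 2) ^ 2 ∂γ := by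
        rw [integral_add hr hs, integral_const_mul, integral_const_mul, integral_indicator₀ hD]
        simp [gaussianDist, gaussianVol, γ]
    _ ≤ _ := by
        gcongr
        exact integral_norm_sq_sub_sq_stdGaussian_le

/-- The total convex influence of an intersection of `M ≥ 2` halfspaces is `O(log M)`, whatever the
dimension. -/
theorem totalConvexInfluence_le_log {M : ℕ} (hM : 2 ≤ M) (hL : IsHalfspaceInter M L) :
    totalConvexInfluence L ≤ 652 * Real.log M := by
  obtain ⟨v, θ, hv, rfl⟩ := hL
  have hlog : (1 : ℝ) / 2 ≤ Real.log M := by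
    have : Real.log 2 ≤ Real.log M := Real.log_le_log (by norm_num) (by exact_mod_cast hM)
    linarith [Real.log_two_gt_d9]
  have hM0 : (0 : ℝ) < M := by exact_mod_cast (by omega : 0 < M)
  set l := Real.log M with hl
  -- this choice makes `M exp (-T² / 4) = 1`
  set T := 2 * Real.sqrt l with hT
  have hT0 : 0 ≤ T := by positivity
  have hT2 : T ^ 2 = 4 * l := by rw [hT, mul_pow, Real.sq_sqrt (by linarith)]; ring
  have hT1 : 1 ≤ T := by nlinarith
  -- any `h` with `h n ≤ 1` and `h T (1 + T) ≤ 1` will do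
  set h := 1 / (n + T * (1 + T)) with hh
  have hden : 0 < (n : ℝ) + T * (1 + T) := by positivity
  have hh0 : 0 < h := by positivity
  have hmul : h * (n + T * (1 + T)) = 1 := by rw [hh]; field_simp
  have hn : 0 ≤ h * n := by positivity
  have hTT : 0 ≤ h * (T * (1 + T)) := by positivity
  have hmeas : MeasurableSet (⋂ i, {x : EuclideanSpace ℝ (Fin n) | inner ℝ x (v i) ≤ θ i}) :=
    MeasurableSet.iInter fun i => measurableSet_le (by fun_prop) (by fun_prop)
  have h1 := mul_setIntegral_le_dilation_sub hmeas hh0.le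
  have h2 := stdGaussian_dilation_sub_le v θ hv hT0 hh0.le (by linarith)
  rw [← totalConvexInfluence_eq_setIntegral hmeas.nullMeasurableSet] at h1
  have hM1 : M * Real.exp (-T ^ 2 / 4) = 1 := by
    rw [hT2, show -(4 * l) / 4 = -l by ring, Real.exp_neg, hl, Real.exp_log hM0,
      mul_inv_cancel₀ hM0.ne']
  rw [hM1] at h2
  have h3 : totalConvexInfluence (⋂ i, {x : EuclideanSpace ℝ (Fin n) | inner ℝ x (v i) ≤ θ i})
      ≤ T * (1 + T) * Real.exp 4 + 1 + h * n := by
    refine le_of_mul_le_mul_left ?_ hh0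
    nlinarith
  have he : Real.exp 4 ≤ 81 := by
    have : Real.exp 4 = Real.exp 1 ^ 4 := by rw [← Real.exp_nat_mul]; norm_num
    rw [this]
    calc Real.exp 1 ^ 4 ≤ 3 ^ 4 := by gcongr; linarith [Real.exp_one_lt_d9]
      _ = 81 := by norm_num
  have h4 : T * (1 + T) ≤ 8 * l := by nlinarith
  have h5 : T * (1 + T) * Real.exp 4 ≤ 8 * l * 81 := by gcongr
  linarith

/-- A single halfspace (or the whole space) is far from every symmetric set of volume near `1/2`:
a halfspace and its reflection either cover the whole space or are disjoint. -/
lemma two_le_of_gaussianDist_lt {M : ℕ} (hsymm : ∀ x ∈ K, -x ∈ K)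
    (hvol : |gaussianVol K - 1 / 2| ≤ 1 / 4) (hL : IsHalfspaceInter M L)
    (hd : gaussianDist K L < 1 / 8) : 2 ≤ M := by
  by_contra! hM
  obtain ⟨v, θ, hv, rfl⟩ := hL
  rw [abs_le] at hvol
  set γ := stdGaussian (EuclideanSpace ℝ (Fin n))
  set L : Set (EuclideanSpace ℝ (Fin n)) := ⋂ i, {x | inner ℝ x (v i) ≤ θ i} with hLdef
  have hrefl : γ.real (Neg.neg ⁻¹' symmDiff K L) = γ.real (symmDiff K L) := by
    have e : γ.map (MeasurableEquiv.neg _) = γ := stdGaussian_map (LinearIsometryEquiv.neg ℝ)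
    conv_rhs => rw [← e, measureReal_def, MeasurableEquiv.map_apply]
    rfl
  have hU : γ.real (symmDiff K L ∪ Neg.neg ⁻¹' symmDiff K L) < 1 / 4 := by
    have := measureReal_union_le (μ := γ) (symmDiff K L) (Neg.neg ⁻¹' symmDiff K L)
    have hd' : γ.real (symmDiff K L) < 1 / 8 := hd
    linarith
  have hKc : γ.real (K ∪ Kᶜ) ≤ γ.real K + γ.real Kᶜ := measureReal_union_le _ _
  rw [Set.union_compl_self, probReal_univ] at hKc
  have hKv : γ.real K = gaussianVol K := rfl
  rcases Classical.em (∀ x, x ∈ L ∨ -x ∈ L) with hcov | hcov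
  · have : Kᶜ ⊆ symmDiff K L ∪ Neg.neg ⁻¹' symmDiff K L := by
      intro x hx
      rcases hcov x with h | h
      · exact Or.inl (Or.inr ⟨h, hx⟩)
      · exact Or.inr (Or.inr ⟨h, fun h' => hx (by simpa using hsymm _ h')⟩)
    have := measureReal_mono (μ := γ) this
    linarith
  · have hdis : ∀ x, x ∉ L ∨ -x ∉ L := by
      intro x
      by_contra! hx
      refine hcov fun y => ?_
      by_contra! hy
      simp only [hLdef, Set.mem_iInter, Set.mem_ofPred_eq, not_forall, inner_neg_left] at hx hy
      obtain ⟨⟨i, hi⟩, ⟨j, hj⟩⟩ := hy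
      -- there is at most one constraint, so `y` and `-y` violate the same one
      obtain rfl : i = j := Fin.ext (by omega)
      linarith [hx.1 i, hx.2 i]
    have : K ⊆ symmDiff K L ∪ Neg.neg ⁻¹' symmDiff K L := by
      intro x hx
      rcases hdis x with h | h
      · exact Or.inl (Or.inl ⟨hx, h⟩)
      · exact Or.inr (Or.inl ⟨hsymm x hx, h⟩)
    have := measureReal_mono (μ := γ) this
    linarith

end Influence

theorem theorem9p5 :
    ∃ c : ℝ, 0 < c ∧
      ∀ (n : ℕ) (K : Set (EuclideanSpace ℝ (Fin n))),
        Convex ℝ K → (∀ x ∈ K, -x ∈ K) →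
        |gaussianVol K - 1 / 2| ≤ c →
        0.1 * Real.sqrt n ≤ totalConvexInfluence K →
        ∀ (M : ℕ) (L : Set (EuclideanSpace ℝ (Fin n))),
          IsHalfspaceInter M L →
          gaussianDist K L ≤ 6.25 * (10 : ℝ) ^ (-7 : ℤ) →
          (2 : ℝ) ^ (5.1 * (10 : ℝ) ^ (-6 : ℤ) * Real.sqrt n) ≤ (M : ℝ) := by
  refine ⟨1 / 4, by norm_num, fun n K hK hsymm hvol hinf M L hL hd => ?_⟩
  have hd' : gaussianDist K L ≤ 1 / 1600000 := hd.trans (by norm_num)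
  have hM := two_le_of_gaussianDist_lt hsymm hvol hL (by linarith)
  have hM0 : (0 : ℝ) < M := by exact_mod_cast (by omega : 0 < M)
  rw [Real.rpow_def_of_pos two_pos, ← Real.le_log_iff_exp_le hM0]
  rcases Nat.eq_zero_or_pos n with rfl | hn
  · simpa using Real.log_natCast_nonneg M
  have hs : 0 < Real.sqrt n := Real.sqrt_pos.2 (by exact_mod_cast hn)
  have hLm : NullMeasurableSet L (stdGaussian (EuclideanSpace ℝ (Fin n))) := by
    obtain ⟨v, θ, -, rfl⟩ := hL
    exact (MeasurableSet.iInter fun i =>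
      measurableSet_le (by fun_prop) (by fun_prop)).nullMeasurableSet
  -- with `a = 10⁴ √n` both error terms are below `0.005 √n`
  have h1 := totalConvexInfluence_sub_le (nullMeasurableSet_stdGaussian_of_convex hK) hLm
    (show 0 < 10000 * Real.sqrt n by positivity)
  have h2 := totalConvexInfluence_le_log hM hL
  have e : 1 / (2 * (10000 * Real.sqrt n)) * (96 * n) = 96 / 20000 * Real.sqrt n := by
    have := Real.mul_self_sqrt (Nat.cast_nonneg (α := ℝ) n)
    field_simp
    nlinarith
  rw [e] at h1
  have h3 : 10000 * Real.sqrt n / 2 * gaussianDist K L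
      ≤ 10000 * Real.sqrt n / 2 * (1 / 1600000) := by gcongr
  have h4 : Real.log 2 * (5.1 * (10 : ℝ) ^ (-6 : ℤ) * Real.sqrt n)
      ≤ 1 * (5.1 * (10 : ℝ) ^ (-6 : ℤ) * Real.sqrt n) := by
    gcongr
    linarith [Real.log_two_lt_d9]
  norm_num at h4 hinf ⊢
  linarith
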